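/- Let $n \ge 1$. For $x,y\in\mathbb{Z}^n$ let $x\vee y$, $x\wedge y$ denote the componentwise maximum and minimum, and let $\lceil\cdot\rceil$, $\lfloor\cdot\rfloor$ act componentwise. For $f:\mathbb{Z}^n\to\mathbb{R}\cup\{+\infty\}$ write $\operatorname{dom} f=\{x : f(x)<+\infty\}$, and for $S\subseteq\mathbb{Z}^n$ let $\delta_S$ be the function equal to $0$ on $S$ and $+\infty$ off $S$. Definitions. - A *box of integers* is a set $\{x\in\mathbb{Z}^n : a_i\le x_i\le b_i \text{ for all } i\}$ with $a\in(\mathbb{Z}\cup\{-\infty\})^n$, $b\in(\mathbb{Z}\cup\{+\infty\})^n$ and $a\le b$. - $f$ is *separable convex* if $f(x)=\sum_{i=1}^n\varphi_i(x_i)$ for all $x \in \mathbb{Z}^n$, with functions $\varphi_i:\mathbb{Z}\to\mathbb{R}\cup\{+\infty\}$ such that $\operatorname{dom}\varphi_i$ is a nonempty interval of integers and $\varphi_i(t-1)+\varphi_i(t+1)\ge 2\varphi_i(t)$ for all $t\in\mathbb{Z}$. - $f$ is *multimodular* if $\operatorname{dom} f\neq\emptyset$ and the function $\tilde f(x_0,x_1,\dots,x_n)=f(x_1-x_0,x_2-x_1,\dots,x_n-x_{n-1})$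 on $\mathbb{Z}^{n+1}$ is submodular, that is, $\tilde f(x)+\tilde f(y)\ge\tilde f(x\vee y)+\tilde f(x\wedge y)$ for all $x,y\in\mathbb{Z}^{n+1}$. A nonempty set $S\subseteq\mathbb{Z}^n$ is multimodular if $\delta_S$ is. - A nonempty set $S\subseteq\mathbb{Z}^n$ is *$L^\natural$-convex* if $x,y\in S$ implies $\lceil (x+y)/2\rceil,\lfloor (x+y)/2\rfloor\in S$. A function $f$ is $L^\natural$-convex if $\operatorname{dom} f\ne\emptyset$ and $f(x)+f(y)\ge f(\lceil (x+y)/2\rceil)+f(\lfloor (x+y)/2\rfloor)$ for all $x,y\in\mathbb{Z}^n$. - A set is *$L^\natural_2$-convex* if it is the Minkowski sum $S_1+S_2$ of two $L^\natural$-convex sets. A function $f:\mathbb{Z}^n\to\mathbb{R}\cup\{+\infty\}$ is $L^\natural_2$-convex if there are two $L^\natural$-convex functions $f_1,f_2$ with $f(x)=\inf\{f_1(y)+f_2(z) : y,z\in\mathbb{Z}^n,\ y+z=x\}$ for all $x\in\mathbb{Z}^n$. Theorem. (1) A set $S\subseteq\mathbb{Z}^n$ is a box of integers if and only if it is both multimodular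 and $L^\natural_2$-convex. (2) A function $f:\mathbb{Z}^n\to\mathbb{R}\cup\{+\infty\}$ is separable convex if and only if it is both multimodular and $L^\natural_2$-convex. -/

import Mathlib

/-!
Functions `f : ℤⁿ → ℝ ∪ {+∞}` are modelled as `f : (Fin n → ℤ) → WithTop ℝ`.
-/

namespace DiscreteConvex

/-- The effective domain `{x | f x < +∞}`. -/
def effDom {X : Type*} (f : X → WithTop ℝ) : Set X := {x | f x < ⊤}

/-- The indicator function of `S`: `0` on `S` and `+∞` off `S`. -/
noncomputable def indicatorFn {n : ℕ} (S : Set (Fin n → ℤ)) : (Fin n → ℤ) → WithTop ℝ :=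
  open Classical in fun x => if x ∈ S then 0 else ⊤

/-- A box of integers `{x ∈ ℤⁿ | a i ≤ x i ≤ b i for all i}`, for some `a ∈ (ℤ ∪ {-∞})ⁿ` and
`b ∈ (ℤ ∪ {+∞})ⁿ` with `a ≤ b`. -/
def IsIntegerBox {n : ℕ} (S : Set (Fin n → ℤ)) : Prop :=
  ∃ (a : Fin n → WithBot ℤ) (b : Fin n → WithTop ℤ),
    (∀ (i : Fin n) (k l : ℤ), a i = (k : WithBot ℤ) → b i = (l : WithTop ℤ) → k ≤ l) ∧
    S = {x | ∀ i, a i ≤ (x i : WithBot ℤ) ∧ (x i : WithTop ℤ) ≤ b i}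

/-- A univariate discrete convex function `φ : ℤ → ℝ ∪ {+∞}`: its effective domain is a
(nonempty) interval of integers and `φ (t - 1) + φ (t + 1) ≥ 2 φ t` for all `t`. -/
def IsUnivariateConvex (φ : ℤ → WithTop ℝ) : Prop :=
  (effDom φ).Nonempty ∧ (effDom φ).OrdConnected ∧
    ∀ t : ℤ, φ t + φ t ≤ φ (t - 1) + φ (t + 1)

/-- Separable convexity: `f x = ∑ i, φ i (x i)` with univariate discrete convex `φ i`. -/
def IsSeparableConvex {n : ℕ} (f : (Fin n → ℤ) → WithTop ℝ) : Prop :=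
  ∃ φ : Fin n → ℤ → WithTop ℝ,
    (∀ i, IsUnivariateConvex (φ i)) ∧ ∀ x, f x = ∑ i, φ i (x i)

/-- Submodularity (`⊔`, `⊓` are the componentwise maximum and minimum). -/
def IsSubmodular {m : ℕ} (f : (Fin m → ℤ) → WithTop ℝ) : Prop :=
  ∀ x y, f (x ⊔ y) + f (x ⊓ y) ≤ f x + f y

/-- The function `(x₀, x₁, …, xₙ) ↦ f (x₁ - x₀, x₂ - x₁, …, xₙ - xₙ₋₁)` on `ℤⁿ⁺¹`. -/
def diffLift {n : ℕ} (f : (Fin n → ℤ) → WithTop ℝ) : (Fin (n + 1) → ℤ) → WithTop ℝ :=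
  fun x => f (fun i => x i.succ - x i.castSucc)

/-- Multimodular functions with values in `ℝ ∪ {+∞}`. -/
def IsMultimodular {n : ℕ} (f : (Fin n → ℤ) → WithTop ℝ) : Prop :=
  (effDom f).Nonempty ∧ IsSubmodular (diffLift f)

/-- Multimodular sets: nonempty sets whose indicator function is multimodular. -/
def IsMultimodularSet {n : ℕ} (S : Set (Fin n → ℤ)) : Prop :=
  S.Nonempty ∧ IsMultimodular (indicatorFn S)

/-- The rounded-up midpoint `⌈(x + y) / 2⌉`, componentwise. -/
noncomputable def midCeil {n : ℕ} (x y : Fin n → ℤ) : Fin n → ℤ :=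
  fun i => ⌈((x i : ℝ) + (y i : ℝ)) / 2⌉

/-- The rounded-down midpoint `⌊(x + y) / 2⌋`, componentwise. -/
noncomputable def midFloor {n : ℕ} (x y : Fin n → ℤ) : Fin n → ℤ :=
  fun i => ⌊((x i : ℝ) + (y i : ℝ)) / 2⌋

theorem midFloor_apply {n : ℕ} (x y : Fin n → ℤ) (i : Fin n) :
    midFloor x y i = (x i + y i) / 2 := by
  unfold midFloor
  rw [Int.floor_eq_iff]
  have h1 : 2 * ((x i + y i) / 2) ≤ x i + y i := by omega
  have h2 : x i + y i < 2 * ((x i + y i) / 2) + 2 := by omega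
  have h1' : (2 : ℝ) * (((x i + y i) / 2 : ℤ) : ℝ) ≤ x i + y i := by exact_mod_cast h1
  have h2' : (x i + y i : ℝ) < 2 * (((x i + y i) / 2 : ℤ) : ℝ) + 2 := by exact_mod_cast h2
  constructor <;> linarith

theorem midCeil_apply {n : ℕ} (x y : Fin n → ℤ) (i : Fin n) :
    midCeil x y i = (x i + y i + 1) / 2 := by
  unfold midCeil
  rw [Int.ceil_eq_iff]
  have h1 : 2 * ((x i + y i + 1) / 2) < x i + y i + 2 := by omega
  have h2 : x i + y i ≤ 2 * ((x i + y i + 1) / 2) := by omega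
  have h1' : (2 : ℝ) * (((x i + y i + 1) / 2 : ℤ) : ℝ) < x i + y i + 2 := by exact_mod_cast h1
  have h2' : (x i + y i : ℝ) ≤ 2 * (((x i + y i + 1) / 2 : ℤ) : ℝ) := by exact_mod_cast h2
  constructor <;> linarith

/-- L♮-convex sets: nonempty and closed under both rounded midpoints. -/
def IsLNatSet {n : ℕ} (S : Set (Fin n → ℤ)) : Prop :=
  S.Nonempty ∧ ∀ x ∈ S, ∀ y ∈ S, midCeil x y ∈ S ∧ midFloor x y ∈ S

/-- L♮-convex functions: discrete midpoint convexity, with nonempty effective domain. -/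
def IsLNatConvex {n : ℕ} (f : (Fin n → ℤ) → WithTop ℝ) : Prop :=
  (effDom f).Nonempty ∧ ∀ x y, f (midCeil x y) + f (midFloor x y) ≤ f x + f y

open scoped Pointwise in
/-- L♮₂-convex sets: Minkowski sums of two L♮-convex sets. -/
def IsL2NatSet {n : ℕ} (S : Set (Fin n → ℤ)) : Prop :=
  ∃ S₁ S₂ : Set (Fin n → ℤ), IsLNatSet S₁ ∧ IsLNatSet S₂ ∧ S = S₁ + S₂

/-- `f` is the integral infimal convolution of `f₁` and `f₂`. The infimum, which need not be
attained, is expressed as a greatest lower bound in `ℝ ∪ {+∞}`, so that the value `-∞` is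
excluded. -/
def IsInfConvolution {n : ℕ} (f f₁ f₂ : (Fin n → ℤ) → WithTop ℝ) : Prop :=
  ∀ x, IsGLB {v | ∃ y z : Fin n → ℤ, x = y + z ∧ v = f₁ y + f₂ z} (f x)

/-- L♮₂-convex functions: infimal convolutions of two L♮-convex functions. -/
def IsL2NatConvex {n : ℕ} (f : (Fin n → ℤ) → WithTop ℝ) : Prop :=
  ∃ f₁ f₂ : (Fin n → ℤ) → WithTop ℝ,
    IsLNatConvex f₁ ∧ IsLNatConvex f₂ ∧ IsInfConvolution f f₁ f₂

end DiscreteConvex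

/-!
# Multimodular and L♮₂-convex means separable convex

The substance is that a multimodular L♮₂-convex function `f` is separable. Write `e i` for the
unit vectors.

* Discrete midpoint convexity implies submodularity (`IsLNatConvex.sup_add_inf_le`). Joining and
  meeting one pair of summands in an infimal convolution therefore shows that, for L♮₂-convex `f`
  and `x j < y j`, the sum `f x + f y` is at least the infimum of `f (x + h) + f (y - h)` over
  `h ≥ 0` with `h j ≥ 1` (`IsL2NatConvex.le_add_of_forall_shift`).
* Multimodularity, read off on suitable lifts to `ℤⁿ⁺¹`, makes all second differences of `f` in
  the directions `e i`, `e j` nonnegative, the case `i = j` included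
  (`IsMultimodular.supermodularAlong_single`). It also refines a shift `± h` inside the effective
  domain, where `h ≥ 0` and `h j ≥ 1`, to the unit step `± e j`
  (`IsMultimodular.add_single_mem_effDom`, `IsMultimodular.sub_single_mem_effDom`).

Together, the effective domain is closed under unit exchanges (`hasUnitExchange_effDom`), and
such sets are exactly boxes. This settles the statement on sets, through indicator functions. On
a box, nonnegativity of second differences telescopes to arbitrary nonnegative directions
(`SupermodularAlong.of_single`). Applying it to the pair obtained by shifting `x = u + e i` and
`y = u + e j` (`i ≠ j`) outwards by `h` gives
`f (x + h) + f (y - h) ≥ f u + f (u + e i + e j)`, hence `f x + f y ≥ f u + f (u + e i + e j)`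
(`submodularAlong_single`). So the mixed second differences vanish, `f` is modular on the lattice
`ℤⁿ` (`sup_add_inf_eq`), and a modular function on a product of chains is a sum of univariate
functions (`piecewise_add_card_nsmul`), here convex.

The converse inclusions come from the inequality `φ p + φ q ≤ φ s + φ t` for univariate convex
`φ`, `p + q = s + t` and `s ≤ p ≤ t` (`IsUnivariateConvex.add_le_add`), applied coordinatewise.
-/

namespace DiscreteConvex

/-! ### Arithmetic and greatest lower bounds in `ℝ ∪ {+∞}` -/

/-- Adding two inequalities and cancelling the intermediate terms, which must be finite. -/
theorem add_le_add_of_telescope {a b c d p q : WithTop ℝ} (hp : p ≠ ⊤) (hq : q ≠ ⊤)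
    (h₁ : a + p ≤ b + q) (h₂ : q + c ≤ p + d) : a + c ≤ b + d := by
  have hpq : p + q ≠ ⊤ := WithTop.add_ne_top.2 ⟨hp, hq⟩
  refine (WithTop.add_le_add_iff_right hpq).1 ?_
  calc a + c + (p + q) = (a + p) + (q + c) := by abel
    _ ≤ (b + q) + (p + d) := add_le_add h₁ h₂
    _ = b + d + (p + q) := by abel

theorem le_add_of_isGLB_left {A : Set (WithTop ℝ)} {a c : WithTop ℝ} (hA : IsGLB A a)
    (v : WithTop ℝ) (h : ∀ w ∈ A, c ≤ w + v) : c ≤ a + v := by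
  induction v with
  | top => simp
  | coe r =>
    have hr : ∀ w : WithTop ℝ, w + (r : WithTop ℝ) + ((-r : ℝ) : WithTop ℝ) = w := by
      intro w
      rw [add_assoc, ← WithTop.coe_add, add_neg_cancel, WithTop.coe_zero, add_zero]
    have hle : c + ((-r : ℝ) : WithTop ℝ) ≤ a := by
      refine hA.2 fun w hw => ?_
      calc c + ((-r : ℝ) : WithTop ℝ) ≤ w + r + ((-r : ℝ) : WithTop ℝ) := by
            gcongr; exact h w hw
        _ = w := hr w
    calc c = c + ((-r : ℝ) : WithTop ℝ) + r := by
          rw [add_assoc, ← WithTop.coe_add, neg_add_cancel, WithTop.coe_zero, add_zero]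
      _ ≤ a + r := by gcongr

theorem le_add_of_isGLB {A B : Set (WithTop ℝ)} {a b c : WithTop ℝ} (hA : IsGLB A a)
    (hB : IsGLB B b) (h : ∀ v ∈ A, ∀ w ∈ B, c ≤ v + w) : c ≤ a + b := by
  refine le_add_of_isGLB_left hA b fun v hv => ?_
  rw [add_comm]
  refine le_add_of_isGLB_left hB v fun w hw => ?_
  rw [add_comm]
  exact h v hv w hw

/-! ### Second differences and telescoping -/

/-- The mixed second difference of `f` in the directions `h` and `k` is nonnegative everywhere. -/
def SupermodularAlong {G : Type*} [Add G] (f : G → WithTop ℝ) (h k : G) : Prop :=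
  ∀ u, f (u + h) + f (u + k) ≤ f u + f (u + h + k)

/-- The mixed second difference of `f` in the directions `h` and `k` is nonpositive everywhere. -/
def SubmodularAlong {G : Type*} [Add G] (f : G → WithTop ℝ) (h k : G) : Prop :=
  ∀ u, f u + f (u + h + k) ≤ f (u + h) + f (u + k)

theorem SupermodularAlong.symm {G : Type*} [AddCommMonoid G] {f : G → WithTop ℝ} {h k : G}
    (H : SupermodularAlong f h k) : SupermodularAlong f k h := fun u => by
  rw [add_comm (f (u + k)), add_right_comm u k h]; exact H u

theorem SubmodularAlong.symm {G : Type*} [AddCommMonoid G] {f : G → WithTop ℝ} {h k : G}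
    (H : SubmodularAlong f h k) : SubmodularAlong f k h := fun u => by
  rw [add_comm (f (u + k)), add_right_comm u k h]; exact H u

/-- Nonnegativity of second differences passes to sums of nonnegative directions: order-convexity
of the effective domain makes the intermediate values finite, so that they cancel. -/
def supermodularSubmonoid {G : Type*} [AddCommGroup G] [PartialOrder G] [IsOrderedAddMonoid G]
    (f : G → WithTop ℝ) (hf : (effDom f).OrdConnected) (h : G) (hh : 0 ≤ h) : AddSubmonoid G where
  carrier := {k | 0 ≤ k ∧ SupermodularAlong f h k}
  zero_mem' := ⟨le_rfl, fun u => by rw [add_zero, add_zero, add_comm]⟩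
  add_mem' := by
    rintro k l ⟨hk, Hk⟩ ⟨hl, Hl⟩
    refine ⟨add_nonneg hk hl, fun u => ?_⟩
    by_cases h₁ : f u = ⊤
    · simp [h₁]
    by_cases h₂ : f (u + h + (k + l)) = ⊤
    · simp [h₂]
    have hmem := hf.out (lt_top_iff_ne_top.2 h₁ : u ∈ effDom f)
      (lt_top_iff_ne_top.2 h₂ : u + h + (k + l) ∈ effDom f)
    have hp : u + k ∈ effDom f := by
      refine hmem ⟨le_add_of_nonneg_right hk, ?_⟩
      have := add_le_add_right (add_nonneg hh hl) (u + k)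
      rw [add_zero] at this
      exact this.trans_eq (by abel)
    have hq : u + h + k ∈ effDom f := by
      refine hmem ⟨?_, ?_⟩
      · rw [add_assoc]; exact le_add_of_nonneg_right (add_nonneg hh hk)
      · rw [← add_assoc]; exact le_add_of_nonneg_right hl
    have H₂ := Hl (u + k)
    rw [add_right_comm u k h, add_assoc u k l, add_assoc (u + h) k l] at H₂
    exact add_le_add_of_telescope hp.ne hq.ne (Hk u) H₂

theorem int_eq_toNat_nsmul {k : ℤ} (hk : 0 ≤ k) : k = k.toNat • (1 : ℤ) := by
  simp [hk]

theorem pi_eq_sum_nsmul_single {n : ℕ} {k : Fin n → ℤ} (hk : 0 ≤ k) :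
    k = ∑ i, (k i).toNat • (Pi.single i 1 : Fin n → ℤ) := by
  ext j
  have hj := hk j
  simp only [Pi.zero_apply] at hj
  simp [Finset.sum_apply, Pi.single_apply, hj]

theorem SupermodularAlong.of_single {n : ℕ} {f : (Fin n → ℤ) → WithTop ℝ}
    (hf : (effDom f).OrdConnected)
    (H : ∀ i j, SupermodularAlong f (Pi.single i 1) (Pi.single j 1)) {h k : Fin n → ℤ}
    (hh : 0 ≤ h) (hk : 0 ≤ k) : SupermodularAlong f h k := by
  have hs : ∀ i, (0 : Fin n → ℤ) ≤ Pi.single i 1 := fun i => by simp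
  have H₁ : ∀ i, SupermodularAlong f k (Pi.single i 1) := by
    intro i
    refine SupermodularAlong.symm ?_
    have : k ∈ supermodularSubmonoid f hf (Pi.single i 1) (hs i) := by
      rw [pi_eq_sum_nsmul_single hk]
      exact sum_mem fun j _ => nsmul_mem (show _ ∈ supermodularSubmonoid f hf _ (hs i) from
        ⟨hs j, H i j⟩) _
    exact this.2
  have : h ∈ supermodularSubmonoid f hf k hk := by
    rw [pi_eq_sum_nsmul_single hh]
    exact sum_mem fun j _ => nsmul_mem (show _ ∈ supermodularSubmonoid f hf k hk from
      ⟨hs j, H₁ j⟩) _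
  exact this.2.symm

/-- Nonpositivity of second differences passes to sums of nonnegative directions whose supports
avoid that of `h`. Finiteness of the intermediate values holds as soon as the effective domain is
an order-convex sublattice. -/
def submodularSubmonoid {n : ℕ} (f : (Fin n → ℤ) → WithTop ℝ) (hf : (effDom f).OrdConnected)
    (hsup : SupClosed (effDom f)) (hinf : InfClosed (effDom f)) (h : Fin n → ℤ) (hh : 0 ≤ h) :
    AddSubmonoid (Fin n → ℤ) where
  carrier := {k | 0 ≤ k ∧ (∀ i, h i = 0 ∨ k i = 0) ∧ SubmodularAlong f h k}
  zero_mem' := ⟨le_rfl, fun i => Or.inr rfl, fun u => by rw [add_zero, add_zero, add_comm]⟩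
  add_mem' := by
    rintro k l ⟨hk, dk, Hk⟩ ⟨hl, dl, Hl⟩
    have dkl : ∀ i, h i = 0 ∨ (k + l) i = 0 := fun i => by
      have := dk i; have := dl i; simp only [Pi.add_apply]; omega
    refine ⟨add_nonneg hk hl, dkl, fun u => ?_⟩
    by_cases h₁ : f (u + h) = ⊤
    · simp [h₁]
    by_cases h₂ : f (u + (k + l)) = ⊤
    · simp [h₂]
    have m₁ : u + h ∈ effDom f := lt_top_iff_ne_top.2 h₁
    have m₂ : u + (k + l) ∈ effDom f := lt_top_iff_ne_top.2 h₂
    have hmem := hf.out (hinf m₁ m₂) (hsup m₁ m₂)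
    have hp : u + h + k ∈ effDom f := by
      refine hmem ⟨fun i => ?_, fun i => ?_⟩ <;>
      · have := hh i; have := hk i; have := hl i; have := dkl i
        simp only [Pi.add_apply, Pi.inf_apply, Pi.sup_apply, Pi.zero_apply] at *
        omega
    have hq : u + k ∈ effDom f := by
      refine hmem ⟨fun i => ?_, fun i => ?_⟩ <;>
      · have := hh i; have := hk i; have := hl i; have := dkl i
        simp only [Pi.add_apply, Pi.inf_apply, Pi.sup_apply, Pi.zero_apply] at *
        omega
    have H₂ := Hl (u + k)
    rw [add_right_comm u k h, add_assoc u k l, add_assoc (u + h) k l] at H₂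
    exact add_le_add_of_telescope hp.ne hq.ne (Hk u) H₂

theorem SubmodularAlong.of_single {n : ℕ} {f : (Fin n → ℤ) → WithTop ℝ}
    (hf : (effDom f).OrdConnected) (hsup : SupClosed (effDom f)) (hinf : InfClosed (effDom f))
    (H : ∀ i j, i ≠ j → SubmodularAlong f (Pi.single i 1) (Pi.single j 1)) {h k : Fin n → ℤ}
    (hh : 0 ≤ h) (hk : 0 ≤ k) (hd : ∀ i, h i = 0 ∨ k i = 0) : SubmodularAlong f h k := by
  have hs : ∀ i, (0 : Fin n → ℤ) ≤ Pi.single i 1 := fun i => by simp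
  have H₁ : ∀ i, k i = 0 → SubmodularAlong f k (Pi.single i 1) := by
    intro i hi
    refine SubmodularAlong.symm ?_
    have : k ∈ submodularSubmonoid f hf hsup hinf (Pi.single i 1) (hs i) := by
      rw [pi_eq_sum_nsmul_single hk]
      refine sum_mem fun j _ => ?_
      by_cases hj : j = i
      · subst hj; simp [hi]
      · refine nsmul_mem (show _ ∈ submodularSubmonoid f hf hsup hinf _ (hs i) from
          ⟨hs j, fun l => ?_, H i j (Ne.symm hj)⟩) _
        by_cases hl : l = i
        · right; subst hl; simp [Ne.symm hj]
        · left; simp [hl]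
    exact this.2.2
  have : h ∈ submodularSubmonoid f hf hsup hinf k hk := by
    rw [pi_eq_sum_nsmul_single hh]
    refine sum_mem fun j _ => ?_
    rcases hd j with hj | hj
    · simp [hj]
    · refine nsmul_mem (show _ ∈ submodularSubmonoid f hf hsup hinf k hk from
        ⟨hs j, fun l => ?_, H₁ j hj⟩) _
      by_cases hl : l = j
      · left; subst hl; exact hj
      · right; simp [hl]
  exact this.2.2.symm

/-! ### Univariate convex functions -/

theorem IsUnivariateConvex.add_le_add {φ : ℤ → WithTop ℝ} (hφ : IsUnivariateConvex φ)
    {s t p q : ℤ} (hsp : s ≤ p) (hpt : p ≤ t) (hpq : p + q = s + t) :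
    φ p + φ q ≤ φ s + φ t := by
  obtain ⟨-, hoc, hc⟩ := hφ
  have h₁₁ : SupermodularAlong φ 1 1 := fun u => by
    simpa using hc (u + 1)
  have h₁ : ∀ k : ℤ, 0 ≤ k → SupermodularAlong φ 1 k := fun k hk => by
    have : k ∈ supermodularSubmonoid φ hoc 1 zero_le_one := by
      rw [int_eq_toNat_nsmul hk]
      exact nsmul_mem (show _ ∈ supermodularSubmonoid φ hoc 1 zero_le_one from
        ⟨zero_le_one, h₁₁⟩) _
    exact this.2
  have h₂ : p - s ∈ supermodularSubmonoid φ hoc (q - s) (by omega) := by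
    rw [int_eq_toNat_nsmul (show 0 ≤ p - s by omega)]
    exact nsmul_mem (show _ ∈ supermodularSubmonoid φ hoc (q - s) (by omega) from
      ⟨zero_le_one, (h₁ _ (by omega)).symm⟩) _
  have := h₂.2.symm s
  rwa [show s + (p - s) = p by ring, show s + (q - s) = q by ring,
    show p + (q - s) = t by omega] at this

/-! ### L♮-convex functions are submodular -/

/-- Induction on the sup-distance of `x` and `y`. At distance at most one the rounded midpoints are
the join and the meet. Otherwise let `p` be the rounded-up midpoint: the pairs `x, p` and `y, p` and
then the pairs of their joins and of their meets are closer, and the four inequalities add up to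
the claim, up to the finite term `2 f p`. -/
theorem IsLNatConvex.sup_add_inf_le_of_dist {n : ℕ} {f : (Fin n → ℤ) → WithTop ℝ}
    (hf : IsLNatConvex f) (m : ℕ) :
    ∀ x y : Fin n → ℤ, (∀ i, x i - y i ≤ m + 1 ∧ y i - x i ≤ m + 1) →
      f (x ⊔ y) + f (x ⊓ y) ≤ f x + f y := by
  induction m with
  | zero =>
    intro x y hxy
    have h₁ : midCeil x y = x ⊔ y := by
      ext i; have := hxy i; rw [midCeil_apply, Pi.sup_apply]; omega
    have h₂ : midFloor x y = x ⊓ y := by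
      ext i; have := hxy i; rw [midFloor_apply, Pi.inf_apply]; omega
    rw [← h₁, ← h₂]
    exact hf.2 x y
  | succ m ih =>
    intro x y hxy
    by_cases htop : f x + f y = ⊤
    · simp [htop]
    set p := midCeil x y with hp_def
    have hpv : ∀ i, p i = (x i + y i + 1) / 2 := fun i => midCeil_apply x y i
    have hp : f p ≠ ⊤ := by
      intro h
      have := hf.2 x y
      rw [← hp_def, h, WithTop.top_add, top_le_iff] at this
      exact htop this
    have e₁ := ih x p fun i => by have := hxy i; have := hpv i; push_cast at *; omega
    have e₂ := ih y p fun i => by have := hxy i; have := hpv i; push_cast at *; omega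
    have e₃ := ih (x ⊔ p) (y ⊔ p) fun i => by
      have := hxy i; have := hpv i; simp only [Pi.sup_apply]; push_cast at *; omega
    have e₄ := ih (x ⊓ p) (y ⊓ p) fun i => by
      have := hxy i; have := hpv i; simp only [Pi.inf_apply]; push_cast at *; omega
    have s₁ : x ⊔ p ⊔ (y ⊔ p) = x ⊔ y := by
      ext i; have := hpv i; simp only [Pi.sup_apply]; omega
    have s₂ : (x ⊔ p) ⊓ (y ⊔ p) = p := by
      ext i; have := hpv i; simp only [Pi.sup_apply, Pi.inf_apply]; omega
    have s₃ : x ⊓ p ⊔ y ⊓ p = p := by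
      ext i; have := hpv i; simp only [Pi.sup_apply, Pi.inf_apply]; omega
    have s₄ : x ⊓ p ⊓ (y ⊓ p) = x ⊓ y := by
      ext i; have := hpv i; simp only [Pi.inf_apply]; omega
    rw [s₁, s₂] at e₃
    rw [s₃, s₄] at e₄
    have hpp : f p + f p ≠ ⊤ := WithTop.add_ne_top.2 ⟨hp, hp⟩
    refine (WithTop.add_le_add_iff_right hpp).1 ?_
    calc f (x ⊔ y) + f (x ⊓ y) + (f p + f p)
        = (f (x ⊔ y) + f p) + (f p + f (x ⊓ y)) := by abel
      _ ≤ (f (x ⊔ p) + f (y ⊔ p)) + (f (x ⊓ p) + f (y ⊓ p)) := add_le_add e₃ e₄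
      _ = (f (x ⊔ p) + f (x ⊓ p)) + (f (y ⊔ p) + f (y ⊓ p)) := by abel
      _ ≤ (f x + f p) + (f y + f p) := add_le_add e₁ e₂
      _ = f x + f y + (f p + f p) := by abel

theorem IsLNatConvex.sup_add_inf_le {n : ℕ} {f : (Fin n → ℤ) → WithTop ℝ}
    (hf : IsLNatConvex f) (x y : Fin n → ℤ) : f (x ⊔ y) + f (x ⊓ y) ≤ f x + f y := by
  refine hf.sup_add_inf_le_of_dist (∑ i, (x i - y i).natAbs) x y fun i => ?_
  have : (x i - y i).natAbs ≤ ∑ i, (x i - y i).natAbs :=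
    Finset.single_le_sum (f := fun i => (x i - y i).natAbs) (fun _ _ => Nat.zero_le _)
      (Finset.mem_univ i)
  omega

/-! ### Exchange for L♮₂-convex functions -/

theorem IsInfConvolution.le_add {n : ℕ} {f f₁ f₂ : (Fin n → ℤ) → WithTop ℝ}
    (H : IsInfConvolution f f₁ f₂) (y z : Fin n → ℤ) : f (y + z) ≤ f₁ y + f₂ z :=
  (H (y + z)).1 ⟨y, z, rfl, rfl⟩

theorem IsInfConvolution.symm {n : ℕ} {f f₁ f₂ : (Fin n → ℤ) → WithTop ℝ}
    (H : IsInfConvolution f f₁ f₂) : IsInfConvolution f f₂ f₁ := fun x => by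
  convert H x using 1
  ext v
  constructor <;>
  · rintro ⟨y, z, rfl, rfl⟩
    exact ⟨z, y, add_comm _ _, add_comm _ _⟩

/-- Replacing the pair `x₁, y₁` of first summands by its join and meet moves `x₁ + x₂` up and
`y₁ + y₂` down by the positive part of `y₁ - x₁`. -/
theorem IsInfConvolution.exists_shift {n : ℕ} {f f₁ f₂ : (Fin n → ℤ) → WithTop ℝ}
    (hf₁ : IsLNatConvex f₁) (H : IsInfConvolution f f₁ f₂) (x₁ x₂ y₁ y₂ : Fin n → ℤ)
    {j : Fin n} (hj : x₁ j < y₁ j) :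
    ∃ h : Fin n → ℤ, 0 ≤ h ∧ 1 ≤ h j ∧
      f (x₁ + x₂ + h) + f (y₁ + y₂ - h) ≤ (f₁ x₁ + f₂ x₂) + (f₁ y₁ + f₂ y₂) := by
  refine ⟨x₁ ⊔ y₁ - x₁, sub_nonneg.2 le_sup_left, ?_, ?_⟩
  · simp only [Pi.sub_apply, Pi.sup_apply]; omega
  · have e₁ : x₁ + x₂ + (x₁ ⊔ y₁ - x₁) = x₁ ⊔ y₁ + x₂ := by abel
    have e₂ : y₁ + y₂ - (x₁ ⊔ y₁ - x₁) = x₁ ⊓ y₁ + y₂ := by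
      ext i; simp only [Pi.add_apply, Pi.sub_apply, Pi.sup_apply, Pi.inf_apply]; omega
    rw [e₁, e₂]
    calc f (x₁ ⊔ y₁ + x₂) + f (x₁ ⊓ y₁ + y₂)
        ≤ (f₁ (x₁ ⊔ y₁) + f₂ x₂) + (f₁ (x₁ ⊓ y₁) + f₂ y₂) :=
          add_le_add (H.le_add _ _) (H.le_add _ _)
      _ = (f₁ (x₁ ⊔ y₁) + f₁ (x₁ ⊓ y₁)) + (f₂ x₂ + f₂ y₂) := by abel
      _ ≤ (f₁ x₁ + f₁ y₁) + (f₂ x₂ + f₂ y₂) := by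
          exact add_le_add (hf₁.sup_add_inf_le x₁ y₁) le_rfl
      _ = (f₁ x₁ + f₂ x₂) + (f₁ y₁ + f₂ y₂) := by abel

/-- Exchange property of L♮₂-convex functions. The infimal convolution need not be attained, so
that no single shift `h` need work for `x` and `y`; a common lower bound `c` takes its place. -/
theorem IsL2NatConvex.le_add_of_forall_shift {n : ℕ} {f : (Fin n → ℤ) → WithTop ℝ}
    (hf : IsL2NatConvex f) {x y : Fin n → ℤ} {j : Fin n} (hj : x j < y j) {c : WithTop ℝ}
    (hc : ∀ h : Fin n → ℤ, 0 ≤ h → 1 ≤ h j → c ≤ f (x + h) + f (y - h)) : c ≤ f x + f y := by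
  obtain ⟨f₁, f₂, hf₁, hf₂, H⟩ := hf
  refine le_add_of_isGLB (H x) (H y) ?_
  rintro _ ⟨x₁, x₂, rfl, rfl⟩ _ ⟨y₁, y₂, rfl, rfl⟩
  simp only [Pi.add_apply] at hj
  rcases lt_or_ge (x₁ j) (y₁ j) with h₁ | h₁
  · obtain ⟨h, h0, hj, hle⟩ := H.exists_shift hf₁ x₁ x₂ y₁ y₂ h₁
    exact (hc h h0 hj).trans hle
  · obtain ⟨h, h0, hj, hle⟩ := H.symm.exists_shift hf₂ x₂ x₁ y₂ y₁
      (show x₂ j < y₂ j by omega)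
    rw [add_comm x₂, add_comm y₂, add_comm (f₂ x₂), add_comm (f₂ y₂)] at hle
    exact (hc h h0 hj).trans hle

/-! ### Multimodular functions -/

/-- The vector of consecutive differences of `F`. -/
def consecDiff {n : ℕ} (F : Fin (n + 1) → ℤ) : Fin n → ℤ := fun i => F i.succ - F i.castSucc

theorem consecDiff_const {n : ℕ} (a : ℤ) :
    consecDiff (fun _ : Fin (n + 1) => a) = 0 := by
  ext i; simp [consecDiff]

theorem consecDiff_partialSum {n : ℕ} (x : Fin n → ℤ) : consecDiff (Fin.partialSum x) = x := by
  ext i; simp [consecDiff, Fin.partialSum_succ]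

/-- Submodularity of the lifted function, seen from an arbitrary base point `x`. -/
theorem IsMultimodular.add_consecDiff_le {n : ℕ} {f : (Fin n → ℤ) → WithTop ℝ}
    (hf : IsMultimodular f) (x : Fin n → ℤ) (F G : Fin (n + 1) → ℤ) :
    f (x + consecDiff (F ⊔ G)) + f (x + consecDiff (F ⊓ G)) ≤
      f (x + consecDiff F) + f (x + consecDiff G) := by
  have key : ∀ F : Fin (n + 1) → ℤ,
      diffLift f (Fin.partialSum x + F) = f (x + consecDiff F) := by
    intro F
    unfold diffLift
    congr 1
    ext i
    simp only [Pi.add_apply, Fin.partialSum_succ, consecDiff]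
    ring
  have := hf.2 (Fin.partialSum x + F) (Fin.partialSum x + G)
  rwa [← add_sup, ← add_inf, key, key, key, key] at this

theorem IsMultimodular.supermodularAlong_single {n : ℕ} {f : (Fin n → ℤ) → WithTop ℝ}
    (hf : IsMultimodular f) (i j : Fin n) :
    SupermodularAlong f (Pi.single i 1) (Pi.single j 1) := by
  wlog hij : i ≤ j generalizing i j
  · exact (this j i (le_of_not_ge hij)).symm
  intro u
  -- `G` is a lift of `e i + e j`; its join and meet with the constant `1` lift `e j` and `e i`.
  let G : Fin (n + 1) → ℤ := fun k =>
    (if i.castSucc < k then 1 else 0) + (if j.castSucc < k then 1 else 0)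
  have hle := hf.add_consecDiff_le u (fun _ => 1) G
  have hij' : (i : ℕ) ≤ j := hij
  have e₁ : consecDiff ((fun _ => 1) ⊔ G) = Pi.single j 1 := by
    ext l
    simp only [consecDiff, G, Pi.sup_apply, Pi.single_apply, Fin.lt_def, Fin.ext_iff,
      Fin.val_succ, Fin.val_castSucc]
    split_ifs <;> omega
  have e₂ : consecDiff ((fun _ => 1) ⊓ G) = Pi.single i 1 := by
    ext l
    simp only [consecDiff, G, Pi.inf_apply, Pi.single_apply, Fin.lt_def, Fin.ext_iff,
      Fin.val_succ, Fin.val_castSucc]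
    split_ifs <;> omega
  have e₃ : consecDiff G = Pi.single i 1 + Pi.single j 1 := by
    ext l
    simp only [consecDiff, G, Pi.add_apply, Pi.single_apply, Fin.lt_def, Fin.ext_iff,
      Fin.val_succ, Fin.val_castSucc]
    split_ifs <;> omega
  rw [e₁, e₂, e₃, consecDiff_const, add_zero, ← add_assoc] at hle
  rwa [add_comm (f _)]

/-- The lifted effective domain is a sublattice invariant under adding constants, so the increment
leading from one of its points to another may be truncated from below and above. -/
theorem IsMultimodular.clamp_mem_effDom {n : ℕ} {f : (Fin n → ℤ) → WithTop ℝ}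
    (hf : IsMultimodular f) {x : Fin n → ℤ} {F : Fin (n + 1) → ℤ} (hx : x ∈ effDom f)
    (hF : x + consecDiff F ∈ effDom f) (a b : ℤ) :
    x + consecDiff ((F ⊔ fun _ => a) ⊓ fun _ => b) ∈ effDom f := by
  have hconst : ∀ c : ℤ, f (x + consecDiff fun _ : Fin (n + 1) => c) < ⊤ := fun c => by
    rw [consecDiff_const, add_zero]; exact hx
  have h₁ : f (x + consecDiff (F ⊔ fun _ => a)) < ⊤ :=
    (WithTop.add_lt_top.1 ((hf.add_consecDiff_le x F fun _ => a).trans_lt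
      (WithTop.add_lt_top.2 ⟨hF, hconst a⟩))).1
  exact (WithTop.add_lt_top.1 ((hf.add_consecDiff_le x (F ⊔ fun _ => a) fun _ => b).trans_lt
    (WithTop.add_lt_top.2 ⟨h₁, hconst b⟩))).2

theorem monotone_partialSum {n : ℕ} {h : Fin n → ℤ} (hh : 0 ≤ h) :
    Monotone (Fin.partialSum h) := by
  refine Fin.monotone_iff_le_succ.2 fun i => ?_
  rw [Fin.partialSum_succ]
  exact le_add_of_nonneg_right (hh i)

/-- Clamping the partial sums of `h ≥ 0` to the values `c - 1` and `c`, where `c` is the partial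
sum up to `j`, leaves a single jump at `j`. -/
theorem consecDiff_clamp_partialSum {n : ℕ} {h : Fin n → ℤ} (hh : 0 ≤ h) {j : Fin n}
    (hj : 1 ≤ h j) (l : Fin n) :
    min (max (Fin.partialSum h l.succ) (Fin.partialSum h j.succ - 1)) (Fin.partialSum h j.succ) -
      min (max (Fin.partialSum h l.castSucc) (Fin.partialSum h j.succ - 1))
        (Fin.partialSum h j.succ) = (Pi.single j 1 : Fin n → ℤ) l := by
  have hs := Fin.partialSum_succ h j
  rcases lt_trichotomy l j with hl | rfl | hl
  · have h₁ := monotone_partialSum hh (show l.succ ≤ j.castSucc from hl)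
    have h₂ := monotone_partialSum hh (show l.castSucc ≤ j.castSucc from hl.le)
    rw [Pi.single_eq_of_ne hl.ne]
    omega
  · rw [Pi.single_eq_same]
    omega
  · have h₁ := monotone_partialSum hh (show j.succ ≤ l.succ from Nat.succ_le_succ hl.le)
    have h₂ := monotone_partialSum hh (show j.succ ≤ l.castSucc from hl)
    rw [Pi.single_eq_of_ne hl.ne']
    omega

theorem IsMultimodular.add_single_mem_effDom {n : ℕ} {f : (Fin n → ℤ) → WithTop ℝ}
    (hf : IsMultimodular f) {x h : Fin n → ℤ} (hx : x ∈ effDom f) (hxh : x + h ∈ effDom f)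
    (hh : 0 ≤ h) {j : Fin n} (hj : 1 ≤ h j) : x + Pi.single j 1 ∈ effDom f := by
  rw [← consecDiff_partialSum h] at hxh
  convert hf.clamp_mem_effDom hx hxh (Fin.partialSum h j.succ - 1) (Fin.partialSum h j.succ)
    using 2
  ext l
  exact (consecDiff_clamp_partialSum hh hj l).symm

theorem IsMultimodular.sub_single_mem_effDom {n : ℕ} {f : (Fin n → ℤ) → WithTop ℝ}
    (hf : IsMultimodular f) {x h : Fin n → ℤ} (hx : x ∈ effDom f) (hxh : x - h ∈ effDom f)
    (hh : 0 ≤ h) {j : Fin n} (hj : 1 ≤ h j) : x - Pi.single j 1 ∈ effDom f := by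
  have hneg : x - h = x + consecDiff (-Fin.partialSum h) := by
    ext i; simp [consecDiff, Fin.partialSum_succ, sub_eq_add_neg]
  rw [hneg] at hxh
  rw [sub_eq_add_neg]
  convert hf.clamp_mem_effDom hx hxh (-Fin.partialSum h j.succ) (1 - Fin.partialSum h j.succ)
    using 2
  ext l
  have := consecDiff_clamp_partialSum hh hj l
  simp only [Pi.neg_apply, consecDiff, Pi.inf_apply, Pi.sup_apply]
  omega

/-! ### Sets closed under unit exchanges are boxes -/

/-- From any point of `S`, a unit step in one coordinate towards another point of `S` stays
in `S`. -/
def HasUnitExchange {n : ℕ} (S : Set (Fin n → ℤ)) : Prop :=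
  ∀ x ∈ S, ∀ y ∈ S, ∀ i,
    (x i < y i → x + Pi.single i 1 ∈ S) ∧ (y i < x i → x - Pi.single i 1 ∈ S)

theorem HasUnitExchange.update_mem {n : ℕ} {S : Set (Fin n → ℤ)} (hS : HasUnitExchange S)
    {y : Fin n → ℤ} (hy : y ∈ S) (i : Fin n) (t : ℤ) (m : ℕ) :
    ∀ x ∈ S, (x i ≤ t ∧ t ≤ y i ∨ y i ≤ t ∧ t ≤ x i) → (t - x i).natAbs = m →
      Function.update x i t ∈ S := by
  induction m with
  | zero =>
    intro x hx _ hm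
    have : t = x i := by omega
    rwa [this, Function.update_eq_self]
  | succ m ih =>
    intro x hx ht hm
    rcases lt_or_ge (x i) t with h | h
    · have := ih (x + Pi.single i 1) ((hS x hx y hy i).1 (by omega)) (by simp; omega)
        (by simp; omega)
      convert this using 1
      ext j
      by_cases hj : j = i
      · subst hj; simp
      · simp [hj]
    · have := ih (x - Pi.single i 1) ((hS x hx y hy i).2 (by omega)) (by simp; omega)
        (by simp; omega)
      convert this using 1
      ext j
      by_cases hj : j = i
      · subst hj; simp
      · simp [hj]

/-- A set closed under unit exchanges contains every point each of whose coordinates is between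
values attained on the set: the coordinates can be adjusted one after the other. -/
theorem HasUnitExchange.mem_of_forall_between {n : ℕ} {S : Set (Fin n → ℤ)}
    (hS : HasUnitExchange S) (hne : S.Nonempty) {z : Fin n → ℤ}
    (hz : ∀ i, (∃ a ∈ S, a i ≤ z i) ∧ ∃ b ∈ S, z i ≤ b i) : z ∈ S := by
  obtain ⟨x, hx⟩ := hne
  have key : ∀ s : Finset (Fin n), s.piecewise z x ∈ S := by
    intro s
    induction s using Finset.induction_on with
    | empty => simpa using hx
    | insert i s _ ih =>
      rw [Finset.piecewise_insert]
      obtain ⟨⟨a, ha, haz⟩, b, hb, hzb⟩ := hz i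
      rcases le_total (s.piecewise z x i) (z i) with h | h
      · exact hS.update_mem hb i _ _ _ ih (Or.inl ⟨h, hzb⟩) rfl
      · exact hS.update_mem ha i _ _ _ ih (Or.inr ⟨haz, h⟩) rfl
  simpa using key Finset.univ

theorem HasUnitExchange.ordConnected {n : ℕ} {S : Set (Fin n → ℤ)} (hS : HasUnitExchange S) :
    S.OrdConnected :=
  ⟨fun x hx y hy _ hz => hS.mem_of_forall_between ⟨x, hx⟩ fun i =>
    ⟨⟨x, hx, hz.1 i⟩, y, hy, hz.2 i⟩⟩

theorem HasUnitExchange.supClosed {n : ℕ} {S : Set (Fin n → ℤ)} (hS : HasUnitExchange S) :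
    SupClosed S := fun x hx y hy => hS.mem_of_forall_between ⟨x, hx⟩ fun i => by
  refine ⟨⟨x, hx, le_sup_left⟩, ?_⟩
  rcases le_total (x i) (y i) with h | h
  · exact ⟨y, hy, by simp [h]⟩
  · exact ⟨x, hx, by simp [h]⟩

theorem HasUnitExchange.infClosed {n : ℕ} {S : Set (Fin n → ℤ)} (hS : HasUnitExchange S) :
    InfClosed S := fun x hx y hy => hS.mem_of_forall_between ⟨x, hx⟩ fun i => by
  refine ⟨?_, ⟨x, hx, inf_le_left⟩⟩
  rcases le_total (x i) (y i) with h | h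
  · exact ⟨x, hx, by simp [h]⟩
  · exact ⟨y, hy, by simp [h]⟩

theorem exists_withBot_le_iff {T : Set ℤ} (hT : T.Nonempty) :
    ∃ a : WithBot ℤ, ∀ t : ℤ, a ≤ (t : WithBot ℤ) ↔ ∃ s ∈ T, s ≤ t := by
  by_cases hb : ∃ b : ℤ, ∀ z : ℤ, z ∈ T → b ≤ z
  · obtain ⟨m, hm, hmin⟩ := Int.exists_least_of_bdd hb hT
    refine ⟨m, fun t => ?_⟩
    rw [WithBot.coe_le_coe]
    exact ⟨fun h => ⟨m, hm, h⟩, fun ⟨s, hs, hst⟩ => (hmin s hs).trans hst⟩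
  · push Not at hb
    exact ⟨⊥, fun t => ⟨fun _ => let ⟨s, hs, h⟩ := hb t; ⟨s, hs, h.le⟩, fun _ => bot_le⟩⟩

theorem exists_le_withTop_iff {T : Set ℤ} (hT : T.Nonempty) :
    ∃ b : WithTop ℤ, ∀ t : ℤ, (t : WithTop ℤ) ≤ b ↔ ∃ s ∈ T, t ≤ s := by
  by_cases hb : ∃ b : ℤ, ∀ z : ℤ, z ∈ T → z ≤ b
  · obtain ⟨m, hm, hmax⟩ := Int.exists_greatest_of_bdd hb hT
    refine ⟨m, fun t => ?_⟩
    rw [WithTop.coe_le_coe]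
    exact ⟨fun h => ⟨m, hm, h⟩, fun ⟨s, hs, hst⟩ => hst.trans (hmax s hs)⟩
  · push Not at hb
    exact ⟨⊤, fun t => ⟨fun _ => let ⟨s, hs, h⟩ := hb t; ⟨s, hs, h.le⟩, fun _ => le_top⟩⟩

theorem HasUnitExchange.isIntegerBox {n : ℕ} {S : Set (Fin n → ℤ)} (hS : HasUnitExchange S)
    (hne : S.Nonempty) : IsIntegerBox S := by
  have hT : ∀ i, ((fun x : Fin n → ℤ => x i) '' S).Nonempty := fun i => hne.image _
  choose a ha using fun i => exists_withBot_le_iff (hT i)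
  choose b hb using fun i => exists_le_withTop_iff (hT i)
  simp only [Set.exists_mem_image] at ha hb
  obtain ⟨x, hx⟩ := hne
  refine ⟨a, b, fun i k l hk hl => ?_, ?_⟩
  · have h₁ := (ha i (x i)).2 ⟨x, hx, le_rfl⟩
    have h₂ := (hb i (x i)).2 ⟨x, hx, le_rfl⟩
    rw [hk, WithBot.coe_le_coe] at h₁
    rw [hl, WithTop.coe_le_coe] at h₂
    exact h₁.trans h₂
  · ext z
    simp only [Set.mem_ofPred_eq, ha, hb]
    exact ⟨fun hz i => ⟨⟨z, hz, le_rfl⟩, z, hz, le_rfl⟩, hS.mem_of_forall_between ⟨x, hx⟩⟩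

/-! ### Multimodular L♮₂-convex functions are separable -/

theorem hasUnitExchange_effDom {n : ℕ} {f : (Fin n → ℤ) → WithTop ℝ} (hm : IsMultimodular f)
    (hl : IsL2NatConvex f) : HasUnitExchange (effDom f) := by
  -- With `c = ⊤`, the exchange property produces a shift that stays in the effective domain.
  have key : ∀ x ∈ effDom f, ∀ y ∈ effDom f, ∀ i, x i < y i →
      ∃ h : Fin n → ℤ, 0 ≤ h ∧ 1 ≤ h i ∧ x + h ∈ effDom f ∧ y - h ∈ effDom f := by
    intro x hx y hy i hi
    by_contra! hcon
    refine (WithTop.add_lt_top.2 ⟨hx, hy⟩).not_ge (hl.le_add_of_forall_shift hi ?_)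
    intro h h0 h1
    by_contra! hlt
    have := WithTop.add_lt_top.1 hlt
    exact hcon h h0 h1 this.1 this.2
  intro x hx y hy i
  constructor
  · intro hi
    obtain ⟨h, h0, h1, hxh, -⟩ := key x hx y hy i hi
    exact hm.add_single_mem_effDom hx hxh h0 h1
  · intro hi
    obtain ⟨h, h0, h1, -, hxh⟩ := key y hy x hx i hi
    exact hm.sub_single_mem_effDom hx hxh h0 h1

theorem submodularAlong_single {n : ℕ} {f : (Fin n → ℤ) → WithTop ℝ} (hm : IsMultimodular f)
    (hl : IsL2NatConvex f) {i j : Fin n} (hij : i ≠ j) :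
    SubmodularAlong f (Pi.single i 1) (Pi.single j 1) := by
  intro u
  have hoc := (hasUnitExchange_effDom hm hl).ordConnected
  refine hl.le_add_of_forall_shift (j := j) (by simp [hij.symm]) fun h h0 h1 => ?_
  -- The pair `u`, `u + e i + e j` lies between `u + e j - h` and `u + e i + h`.
  have hk : 0 ≤ h - Pi.single j 1 := by
    intro l
    have := h0 l
    by_cases hlj : l = j
    · subst hlj; simpa using h1
    · simpa [hlj] using this
  have hle := SupermodularAlong.of_single hoc hm.supermodularAlong_single hk
    (add_nonneg h0 (by simp : (0 : Fin n → ℤ) ≤ Pi.single i 1)) (u + Pi.single j 1 - h)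
  rw [show u + Pi.single j 1 - h + (h - Pi.single j 1) = u by abel,
    show u + Pi.single j 1 - h + (h + Pi.single i 1) = u + Pi.single i 1 + Pi.single j 1 by abel,
    show u + (h + Pi.single i 1) = u + Pi.single i 1 + h by abel] at hle
  rwa [add_comm (f (u + Pi.single i 1 + h))]

theorem sup_add_inf_eq {n : ℕ} {f : (Fin n → ℤ) → WithTop ℝ} (hm : IsMultimodular f)
    (hl : IsL2NatConvex f) (x y : Fin n → ℤ) : f (x ⊔ y) + f (x ⊓ y) = f x + f y := by
  have hE := hasUnitExchange_effDom hm hl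
  have hh : 0 ≤ x - x ⊓ y := sub_nonneg.2 inf_le_left
  have hk : 0 ≤ y - x ⊓ y := sub_nonneg.2 inf_le_right
  have h₁ := SupermodularAlong.of_single hE.ordConnected hm.supermodularAlong_single hh hk (x ⊓ y)
  have h₂ := SubmodularAlong.of_single hE.ordConnected hE.supClosed hE.infClosed
    (fun i j hij => submodularAlong_single hm hl hij) hh hk
    (fun i => by simp only [Pi.sub_apply, Pi.inf_apply]; omega) (x ⊓ y)
  have e : x ⊓ y + (x - x ⊓ y) + (y - x ⊓ y) = x ⊔ y := by
    ext i; simp only [Pi.add_apply, Pi.sub_apply, Pi.inf_apply, Pi.sup_apply]; omega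
  rw [e, add_sub_cancel, add_sub_cancel] at h₁ h₂
  rw [add_comm]
  exact le_antisymm h₂ h₁

/-- For a function that is modular on the lattice `ℤⁿ`, the effect of changing one coordinate
does not depend on the other coordinates: both sides have the same joins and meets. -/
theorem add_update_eq {n : ℕ} {f : (Fin n → ℤ) → WithTop ℝ}
    (hf : ∀ x y, f (x ⊔ y) + f (x ⊓ y) = f x + f y) {z b : Fin n → ℤ} {i : Fin n}
    (hz : z i = b i) (t : ℤ) :
    f (Function.update z i t) + f b = f z + f (Function.update b i t) := by
  rw [← hf (Function.update z i t), ← hf z]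
  congr 2 <;> ext l <;>
  · simp only [Pi.sup_apply, Pi.inf_apply, Function.update_apply]
    split_ifs with h
    · subst h; omega
    · rfl

/-- Changing the coordinates in `s` one after the other. The identity is kept free of subtraction,
so that it holds for infinite values as well. -/
theorem piecewise_add_card_nsmul {n : ℕ} {f : (Fin n → ℤ) → WithTop ℝ}
    (hf : ∀ x y, f (x ⊔ y) + f (x ⊓ y) = f x + f y) (x b : Fin n → ℤ) (s : Finset (Fin n)) :
    f (s.piecewise x b) + s.card • f b = ∑ i ∈ s, f (Function.update b i (x i)) + f b := by
  induction s using Finset.induction_on with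
  | empty => simp
  | insert i s hi ih =>
    rw [Finset.piecewise_insert, Finset.card_insert_of_notMem hi, Finset.sum_insert hi,
      succ_nsmul']
    have := add_update_eq hf (z := s.piecewise x b) (b := b) (i := i) (by simp [hi]) (x i)
    rw [← add_assoc, this, add_right_comm, ih]
    abel

theorem isSeparableConvex_of_multimodular {n : ℕ} (hn : 1 ≤ n) {f : (Fin n → ℤ) → WithTop ℝ}
    (hm : IsMultimodular f) (hl : IsL2NatConvex f) : IsSeparableConvex f := by
  have hE := hasUnitExchange_effDom hm hl
  have hmod := sup_add_inf_eq hm hl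
  obtain ⟨b, hb⟩ := hm.1
  obtain ⟨r, hr⟩ := WithTop.ne_top_iff_exists.1 (show f b ≠ ⊤ from hb.ne)
  -- The values at `b` counted too often are removed in equal parts from the `n` summands.
  let c : ℝ := (r - n * r) / n
  refine ⟨fun i t => f (Function.update b i t) + c, fun i => ⟨⟨b i, ?_⟩, ?_, fun t => ?_⟩,
    fun x => ?_⟩
  · simpa [effDom] using hb
  · refine ⟨fun s hs t ht v hv => ?_⟩
    have hdom : ∀ t, t ∈ effDom (fun t => f (Function.update b i t) + (c : WithTop ℝ)) ↔
        Function.update b i t ∈ effDom f := fun t => by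
      simp [effDom]
    rw [hdom] at hs ht ⊢
    exact hE.ordConnected.out hs ht
      ⟨update_le_update_iff.2 ⟨hv.1, fun _ _ => le_rfl⟩,
        update_le_update_iff.2 ⟨hv.2, fun _ _ => le_rfl⟩⟩
  · have h := hm.supermodularAlong_single i i (Function.update b i (t - 1))
    have e : ∀ s d : ℤ, Function.update b i s + Pi.single i d = Function.update b i (s + d) := by
      intro s d
      ext l
      by_cases hli : l = i
      · subst hli; simp
      · simp [hli]
    rw [e, e, sub_add_cancel] at h
    calc f (Function.update b i t) + (c : WithTop ℝ) + (f (Function.update b i t) + c)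
        = (f (Function.update b i t) + f (Function.update b i t)) + (c + c) := by abel
      _ ≤ (f (Function.update b i (t - 1)) + f (Function.update b i (t + 1))) + (c + c) := by
          exact add_le_add h le_rfl
      _ = _ := add_add_add_comm _ _ _ _
  · have h := piecewise_add_card_nsmul hmod x b Finset.univ
    rw [Finset.piecewise_univ, Finset.card_univ, Fintype.card_fin, ← hr] at h
    have hfin : n • (r : WithTop ℝ) ≠ ⊤ := by
      rw [← WithTop.coe_nsmul]; exact WithTop.coe_ne_top
    refine (WithTop.add_right_inj hfin).1 ?_
    rw [h, Finset.sum_add_distrib, Finset.sum_const, Finset.card_univ, Fintype.card_fin,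
      add_assoc, ← WithTop.coe_nsmul, ← WithTop.coe_nsmul, ← WithTop.coe_add]
    congr 2
    have : (n : ℝ) ≠ 0 := by positivity
    simp only [nsmul_eq_mul, c]
    field_simp
    ring

/-! ### Separable convex functions are multimodular and L♮₂-convex -/

theorem IsSeparableConvex.effDom_nonempty {n : ℕ} {f : (Fin n → ℤ) → WithTop ℝ}
    (hf : IsSeparableConvex f) : (effDom f).Nonempty := by
  obtain ⟨φ, hφ, hf⟩ := hf
  choose t ht using fun i => (hφ i).1
  refine ⟨t, ?_⟩
  change f t < ⊤
  rw [hf]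
  exact WithTop.sum_lt_top.2 fun i _ => ht i

theorem IsUnivariateConvex.sup_add_inf_le {φ : ℤ → WithTop ℝ} (hφ : IsUnivariateConvex φ)
    (x₀ x₁ y₀ y₁ : ℤ) :
    φ (x₁ ⊔ y₁ - x₀ ⊔ y₀) + φ (x₁ ⊓ y₁ - x₀ ⊓ y₀) ≤ φ (x₁ - x₀) + φ (y₁ - y₀) := by
  rcases le_total (x₁ - x₀) (y₁ - y₀) with h | h
  · exact hφ.add_le_add (by omega) (by omega) (by omega)
  · rw [add_comm (φ (x₁ - x₀))]
    exact hφ.add_le_add (by omega) (by omega) (by omega)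

theorem IsSeparableConvex.isMultimodular {n : ℕ} {f : (Fin n → ℤ) → WithTop ℝ}
    (hf : IsSeparableConvex f) : IsMultimodular f := by
  refine ⟨hf.effDom_nonempty, fun x y => ?_⟩
  obtain ⟨φ, hφ, hf⟩ := hf
  simp only [diffLift, hf]
  rw [← Finset.sum_add_distrib, ← Finset.sum_add_distrib]
  exact Finset.sum_le_sum fun i _ => (hφ i).sup_add_inf_le _ _ _ _

theorem IsSeparableConvex.isLNatConvex {n : ℕ} {f : (Fin n → ℤ) → WithTop ℝ}
    (hf : IsSeparableConvex f) : IsLNatConvex f := by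
  refine ⟨hf.effDom_nonempty, fun x y => ?_⟩
  obtain ⟨φ, hφ, hf⟩ := hf
  simp only [hf, midCeil_apply, midFloor_apply]
  rw [← Finset.sum_add_distrib, ← Finset.sum_add_distrib]
  refine Finset.sum_le_sum fun i _ => ?_
  rcases le_total (x i) (y i) with h | h
  · exact (hφ i).add_le_add (by omega) (by omega) (by omega)
  · rw [add_comm (φ i (x i))]
    exact (hφ i).add_le_add (by omega) (by omega) (by omega)

theorem effDom_indicatorFn {n : ℕ} (S : Set (Fin n → ℤ)) : effDom (indicatorFn S) = S := by
  ext x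
  by_cases hx : x ∈ S <;> simp [effDom, indicatorFn, hx]

theorem indicatorFn_of_mem {n : ℕ} {S : Set (Fin n → ℤ)} {x : Fin n → ℤ} (hx : x ∈ S) :
    indicatorFn S x = 0 := by simp [indicatorFn, hx]

theorem indicatorFn_of_notMem {n : ℕ} {S : Set (Fin n → ℤ)} {x : Fin n → ℤ} (hx : x ∉ S) :
    indicatorFn S x = ⊤ := by simp [indicatorFn, hx]

theorem indicatorFn_nonneg {n : ℕ} (S : Set (Fin n → ℤ)) (x : Fin n → ℤ) :
    0 ≤ indicatorFn S x := by
  by_cases hx : x ∈ S <;> simp [indicatorFn, hx]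

theorem IsLNatSet.isLNatConvex_indicatorFn {n : ℕ} {S : Set (Fin n → ℤ)} (hS : IsLNatSet S) :
    IsLNatConvex (indicatorFn S) := by
  refine ⟨by rw [effDom_indicatorFn]; exact hS.1, fun x y => ?_⟩
  by_cases hx : x ∈ S
  · by_cases hy : y ∈ S
    · rw [indicatorFn_of_mem (hS.2 x hx y hy).1, indicatorFn_of_mem (hS.2 x hx y hy).2,
        indicatorFn_of_mem hx, indicatorFn_of_mem hy]
    · simp [indicatorFn_of_notMem hy]
  · simp [indicatorFn_of_notMem hx]

theorem isLNatSet_singleton_zero {n : ℕ} : IsLNatSet ({0} : Set (Fin n → ℤ)) := by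
  refine ⟨Set.singleton_nonempty 0, ?_⟩
  rintro _ rfl _ rfl
  constructor <;> refine Set.mem_singleton_iff.2 (funext fun i => ?_)
  · simp [midCeil_apply]
  · simp [midFloor_apply]

theorem IsLNatConvex.isL2NatConvex {n : ℕ} {f : (Fin n → ℤ) → WithTop ℝ}
    (hf : IsLNatConvex f) : IsL2NatConvex f := by
  refine ⟨f, indicatorFn {0}, hf, isLNatSet_singleton_zero.isLNatConvex_indicatorFn,
    fun x => ⟨?_, fun v hv => hv ⟨x, 0, by simp, ?_⟩⟩⟩
  · rintro _ ⟨y, z, rfl, rfl⟩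
    by_cases hz : z = 0
    · subst hz
      rw [add_zero]
      exact le_add_of_nonneg_right (indicatorFn_nonneg _ _)
    · rw [indicatorFn_of_notMem (by simpa using hz)]
      simp
  · rw [indicatorFn_of_mem (Set.mem_singleton _), add_zero]

/-! ### Sets through their indicator functions -/

open scoped Pointwise in
theorem IsL2NatSet.isL2NatConvex_indicatorFn {n : ℕ} {S : Set (Fin n → ℤ)} (hS : IsL2NatSet S) :
    IsL2NatConvex (indicatorFn S) := by
  obtain ⟨S₁, S₂, h₁, h₂, rfl⟩ := hS
  refine ⟨indicatorFn S₁, indicatorFn S₂, h₁.isLNatConvex_indicatorFn,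
    h₂.isLNatConvex_indicatorFn, fun x => ⟨?_, fun v hv => ?_⟩⟩
  · rintro _ ⟨y, z, rfl, rfl⟩
    by_cases hy : y ∈ S₁
    · by_cases hz : z ∈ S₂
      · rw [indicatorFn_of_mem (Set.add_mem_add hy hz)]
        exact add_nonneg (indicatorFn_nonneg _ _) (indicatorFn_nonneg _ _)
      · simp [indicatorFn_of_notMem hz]
    · simp [indicatorFn_of_notMem hy]
  · by_cases hx : x ∈ S₁ + S₂
    · obtain ⟨y, hy, z, hz, rfl⟩ := Set.mem_add.1 hx
      rw [indicatorFn_of_mem hx]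
      exact hv ⟨y, z, rfl, by rw [indicatorFn_of_mem hy, indicatorFn_of_mem hz, add_zero]⟩
    · rw [indicatorFn_of_notMem hx]
      exact le_top

theorem IsIntegerBox.nonempty {n : ℕ} {S : Set (Fin n → ℤ)} (hS : IsIntegerBox S) :
    S.Nonempty := by
  obtain ⟨a, b, hab, rfl⟩ := hS
  have : ∀ i, ∃ t : ℤ, a i ≤ (t : WithBot ℤ) ∧ (t : WithTop ℤ) ≤ b i := by
    intro i
    specialize hab i
    cases ha : a i with
    | bot =>
      cases hb : b i with
      | top => exact ⟨0, by simp, by simp⟩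
      | coe l => exact ⟨l, by simp, le_rfl⟩
    | coe k =>
      cases hb : b i with
      | top => exact ⟨k, le_rfl, by simp⟩
      | coe l => exact ⟨k, le_rfl, WithTop.coe_le_coe.2 (hab k l ha hb)⟩
  choose t ht using this
  exact ⟨t, ht⟩

/-- Membership in a box may be checked coordinatewise: it suffices that every coordinate lies
between those of two points of the box. -/
theorem IsIntegerBox.mem_of_forall_between {n : ℕ} {S : Set (Fin n → ℤ)} (hS : IsIntegerBox S)
    {x y z : Fin n → ℤ} (hx : x ∈ S) (hy : y ∈ S)
    (hz : ∀ i, min (x i) (y i) ≤ z i ∧ z i ≤ max (x i) (y i)) : z ∈ S := by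
  obtain ⟨a, b, -, rfl⟩ := hS
  intro i
  obtain ⟨h₁, h₂⟩ := hz i
  constructor
  · rcases min_le_iff.1 h₁ with h | h
    · exact (hx i).1.trans (WithBot.coe_le_coe.2 h)
    · exact (hy i).1.trans (WithBot.coe_le_coe.2 h)
  · rcases le_max_iff.1 h₂ with h | h
    · exact (WithTop.coe_le_coe.2 h).trans (hx i).2
    · exact (WithTop.coe_le_coe.2 h).trans (hy i).2

theorem IsIntegerBox.isMultimodularSet {n : ℕ} {S : Set (Fin n → ℤ)} (hS : IsIntegerBox S) :
    IsMultimodularSet S := by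
  refine ⟨hS.nonempty, by rw [effDom_indicatorFn]; exact hS.nonempty, fun x y => ?_⟩
  simp only [diffLift]
  by_cases hx : (fun i : Fin n => x i.succ - x i.castSucc) ∈ S
  · by_cases hy : (fun i : Fin n => y i.succ - y i.castSucc) ∈ S
    · rw [indicatorFn_of_mem hx, indicatorFn_of_mem hy, indicatorFn_of_mem, indicatorFn_of_mem]
      · exact hS.mem_of_forall_between hx hy fun i => by simp only [Pi.inf_apply]; omega
      · exact hS.mem_of_forall_between hx hy fun i => by simp only [Pi.sup_apply]; omega
    · simp [indicatorFn_of_notMem hy]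
  · simp [indicatorFn_of_notMem hx]

theorem IsIntegerBox.isL2NatSet {n : ℕ} {S : Set (Fin n → ℤ)} (hS : IsIntegerBox S) :
    IsL2NatSet S := by
  refine ⟨S, {0}, ⟨hS.nonempty, fun x hx y hy => ⟨?_, ?_⟩⟩, isLNatSet_singleton_zero,
    by simp⟩
  · exact hS.mem_of_forall_between hx hy fun i => by rw [midCeil_apply]; omega
  · exact hS.mem_of_forall_between hx hy fun i => by rw [midFloor_apply]; omega

theorem isIntegerBox_of_multimodular {n : ℕ} {S : Set (Fin n → ℤ)} (hm : IsMultimodularSet S)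
    (hl : IsL2NatSet S) : IsIntegerBox S := by
  have h := hasUnitExchange_effDom hm.2 hl.isL2NatConvex_indicatorFn
  rw [effDom_indicatorFn] at h
  exact h.isIntegerBox hm.1

end DiscreteConvex

theorem theorem5p4 (n : ℕ) (hn : 1 ≤ n) :
    (∀ S : Set (Fin n → ℤ),
      DiscreteConvex.IsIntegerBox S ↔
        DiscreteConvex.IsMultimodularSet S ∧ DiscreteConvex.IsL2NatSet S) ∧
    (∀ f : (Fin n → ℤ) → WithTop ℝ,
      DiscreteConvex.IsSeparableConvex f ↔
        DiscreteConvex.IsMultimodular f ∧ DiscreteConvex.IsL2NatConvex f) := by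
  refine ⟨fun S => ⟨fun h => ⟨h.isMultimodularSet, h.isL2NatSet⟩, fun h => ?_⟩,
    fun f => ⟨fun h => ⟨h.isMultimodular, h.isLNatConvex.isL2NatConvex⟩, fun h => ?_⟩⟩
  · exact DiscreteConvex.isIntegerBox_of_multimodular h.1 h.2
  · exact DiscreteConvex.isSeparableConvex_of_multimodular hn h.1 h.2
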